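/- Consider $n$ agents and allocation vectors $x\in\{0,1\}^n$ ($x_i=1$ if agent $i$ is served). Let $\mathcal X\subseteq\{0,1\}^n$ be the set of feasible allocations (for instance $\mathcal X=\{0,1\}^n$) and let $c:\{0,1\}^n\to\mathbb R$ be an arbitrary service cost. The valuations $v_1,\dots,v_n$ are independent, and $v_i$ has a distribution with support $[0,b_i]$, $0<b_i<\infty$, with a density $f_i$ that is positive throughout $[0,b_i]$, and with distribution function $F_i$. The virtual valuation for utility of agent $i$ is $\vartheta_i(z)=\frac{1-F_i(z)}{f_i(z)}$. Put $h_i(q)=\vartheta_i(F_i^{-1}(q))$ and $H_i(q)=\int_0^q h_i(r)\,dr$ for $q\in[0,1]$, let $G_i$ be the largest convex function on $[0,1]$ with $G_i\le H_i$, and let $g_i$ be the derivative of $G_i$ where it exists, extended by right-continuity (on $[0,1)$; at $q=1$ take the left derivative). The ironed virtual valuation for utility is $\bar\vartheta_i(z)=g_i(F_i(z))$. A (direct, possibly randomized) mechanism assigns to each reported profile $v$ a random feasible allocation $x(v)\in\mathcal X$ and payments $p_1(v),\dots,p_n(v)\ge 0$, which are burnt (no positive transfers to the agents). Write $x_i(z)$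 and $p_i(z)$ for the probability that agent $i$ is served and its expected payment when it reports $z$ and the other agents report their random valuations. The mechanism has to be Bayesian incentive compatible, $z\,x_i(z)-p_i(z)\ge z\,x_i(w)-p_i(w)$ for all $i$ and all $z,w\in[0,b_i]$, and ex interim individually rational, $z\,x_i(z)-p_i(z)\ge 0$ for all $i$ and all $z\in[0,b_i]$. Its expected residual surplus is $\mathbf E\big[\sum_i (v_i x_i(v)-p_i(v))-c(x(v))\big]$. Theorem. Suppose that a mechanism satisfies the following two conditions. 1. For almost every valuation profile $v$ (in particular, if this holds for every $v$), every allocation that $x(v)$ takes with positive probability lies in $\arg\max_{x'\in\mathcal X}\ \sum_i\bar\vartheta_i(v_i)\,x'_i-c(x')$. 2. For every agent $i$ and every $z\in(0,b_i)$: if $\bar\vartheta_i$ is differentiable at $z$ with $\frac{d}{dz}\bar\vartheta_i(z)=0$, then $x_i(\cdot)$ is differentiable at $z$ with $\frac{d}{dz}x_i(z)=0$. Then the mechanism is optimal: no mechanism has a larger expected residual surplus. -/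

import Mathlib

open MeasureTheory

noncomputable section

namespace MoneyBurning

/-- The distribution of one agent's valuation: it has support `[0, b]` and a density `f` which is
positive throughout this interval (no continuity of `f` is assumed). -/
structure ValuationDist where
  b : ℝ
  f : ℝ → ℝ
  b_pos : 0 < b
  measurable_f : Measurable f
  f_pos : ∀ z ∈ Set.Icc 0 b, 0 < f z
  f_zero : ∀ z, z ∉ Set.Icc 0 b → f z = 0
  lintegral_f : ∫⁻ z, ENNReal.ofReal (f z) = 1

namespace ValuationDist

/-- The probability measure on `ℝ` with density `f`. -/
def law (D : ValuationDist) : Measure ℝ :=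
  volume.withDensity fun z => ENNReal.ofReal (D.f z)

instance (D : ValuationDist) : IsProbabilityMeasure D.law :=
  ⟨by rw [law, withDensity_apply _ MeasurableSet.univ, Measure.restrict_univ, D.lintegral_f]⟩

/-- The cumulative distribution function `F`. -/
def F (D : ValuationDist) (z : ℝ) : ℝ := ProbabilityTheory.cdf D.law z

/-- The inverse `F⁻¹ : [0, 1] → [0, b]` of the cumulative distribution function, which is
continuous and strictly increasing on `[0, b]`. -/
def Finv (D : ValuationDist) (q : ℝ) : ℝ := sInf {z | z ∈ Set.Icc 0 D.b ∧ q ≤ D.F z}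

/-- The virtual valuation for utility, `ϑ(z) = (1 - F(z)) / f(z)`. -/
def virtualValue (D : ValuationDist) (z : ℝ) : ℝ := (1 - D.F z) / D.f z

/-- `h(q) = ϑ(F⁻¹(q))`. -/
def h (D : ValuationDist) (q : ℝ) : ℝ := D.virtualValue (D.Finv q)

/-- `H(q) = ∫₀^q h(r) dr`. -/
def H (D : ValuationDist) (q : ℝ) : ℝ := ∫ r in (0 : ℝ)..q, D.h r

/-- `G` is the convex hull of `H`: the largest convex function on `[0, 1]` that is bounded above
by `H` on `[0, 1]`. -/
def G (D : ValuationDist) (q : ℝ) : ℝ :=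
  sSup {y | ∃ φ : ℝ → ℝ, ConvexOn ℝ (Set.Icc 0 1) φ ∧
    (∀ r ∈ Set.Icc (0 : ℝ) 1, φ r ≤ D.H r) ∧ y = φ q}

/-- `g` is the derivative of the convex function `G` where it exists, extended by right-continuity;
that is, the right derivative of `G` on `[0, 1)`. At the end point `q = 1` it is the left
derivative. -/
def g (D : ValuationDist) (q : ℝ) : ℝ :=
  if q < 1 then derivWithin D.G (Set.Ioi q) q else derivWithin D.G (Set.Iio q) q

/-- The ironed virtual valuation for utility, `ϑ̄(z) = g(F(z))`. -/
def ironed (D : ValuationDist) (z : ℝ) : ℝ := D.g (D.F z)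

end ValuationDist

/-- An allocation says for every agent whether it is served. -/
abbrev Allocation (n : ℕ) := Fin n → Bool

/-- The `0`-`1` entry `xᵢ` of the allocation vector. -/
def Allocation.entry {n : ℕ} (x : Allocation n) (i : Fin n) : ℝ := if x i = true then 1 else 0

/-- The joint law of the independent valuations. -/
def jointLaw {n : ℕ} (D : Fin n → ValuationDist) : Measure (Fin n → ℝ) :=
  Measure.pi fun i => (D i).law

/-- The possible valuation profiles, `∏ᵢ [0, bᵢ]`. -/
def typeSpace {n : ℕ} (D : Fin n → ValuationDist) : Set (Fin n → ℝ) :=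
  {v | ∀ i, v i ∈ Set.Icc 0 (D i).b}

/-- The data of a (possibly randomized) direct mechanism: on the reported profile `v`, the
allocation `x` is chosen with probability `lottery v x`, and agent `i` burns the payment
`pay v i` (in expectation over the randomization of the mechanism). -/
structure DirectMechanism (n : ℕ) where
  lottery : (Fin n → ℝ) → Allocation n → ℝ
  pay : (Fin n → ℝ) → Fin n → ℝ

namespace DirectMechanism

variable {n : ℕ}

/-- `xᵢ(v)`: the probability that agent `i` is served at the profile `v`. -/
def alloc (M : DirectMechanism n) (v : Fin n → ℝ) (i : Fin n) : ℝ :=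
  ∑ x : Allocation n, M.lottery v x * x.entry i

/-- The interim allocation `xᵢ(z) = E_{v₋ᵢ}[xᵢ(z, v₋ᵢ)]`. -/
def interimAlloc (M : DirectMechanism n) (D : Fin n → ValuationDist) (i : Fin n) (z : ℝ) : ℝ :=
  ∫ v, M.alloc (Function.update v i z) i ∂(jointLaw D)

/-- The interim payment `pᵢ(z) = E_{v₋ᵢ}[pᵢ(z, v₋ᵢ)]`. -/
def interimPay (M : DirectMechanism n) (D : Fin n → ValuationDist) (i : Fin n) (z : ℝ) : ℝ :=
  ∫ v, M.pay (Function.update v i z) i ∂(jointLaw D)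

/-- `M` is an admissible mechanism for agents with valuation distributions `D` and the set `X` of
feasible allocations. (The last four conditions imply that `0 ≤ pᵢ(z) ≤ z xᵢ(z) ≤ bᵢ`, so that the
payments are integrable with respect to the joint law as well.) -/
structure IsAdmissible (M : DirectMechanism n) (D : Fin n → ValuationDist)
    (X : Set (Allocation n)) : Prop where
  measurable_lottery : ∀ x, Measurable fun v => M.lottery v x
  lottery_mem : ∀ v, M.lottery v ∈ stdSimplex ℝ (Allocation n)
  /-- Only feasible allocations are ever chosen. -/
  feasible : ∀ v ∈ typeSpace D, ∀ x, 0 < M.lottery v x → x ∈ X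
  measurable_pay : ∀ i, Measurable fun v => M.pay v i
  /-- The expected payment of every type is well defined. -/
  integrable_pay : ∀ i, ∀ z ∈ Set.Icc 0 (D i).b,
    Integrable (fun v => M.pay (Function.update v i z) i) (jointLaw D)
  /-- There are no positive transfers to the agents. -/
  pay_nonneg : ∀ v ∈ typeSpace D, ∀ i, 0 ≤ M.pay v i
  /-- Bayesian incentive compatibility: truthtelling is a Bayes-Nash equilibrium. -/
  incentiveCompatible : ∀ i, ∀ z ∈ Set.Icc 0 (D i).b, ∀ w ∈ Set.Icc 0 (D i).b,
    z * M.interimAlloc D i w - M.interimPay D i w ≤ z * M.interimAlloc D i z - M.interimPay D i z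
  /-- Ex interim individual rationality. -/
  individuallyRational : ∀ i, ∀ z ∈ Set.Icc 0 (D i).b,
    0 ≤ z * M.interimAlloc D i z - M.interimPay D i z

/-- The expected residual surplus `E[∑ᵢ (vᵢ xᵢ(v) - pᵢ(v)) - c(x(v))]`. -/
def expectedResidualSurplus (M : DirectMechanism n) (D : Fin n → ValuationDist)
    (c : Allocation n → ℝ) : ℝ :=
  ∫ v, (∑ i, (v i * M.alloc v i - M.pay v i) - ∑ x : Allocation n, M.lottery v x * c x)
    ∂(jointLaw D)

/-- `M` is optimal: it is admissible, and no admissible mechanism has a larger expected residual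
surplus. -/
def IsOptimal (M : DirectMechanism n) (D : Fin n → ValuationDist) (X : Set (Allocation n))
    (c : Allocation n → ℝ) : Prop :=
  M.IsAdmissible D X ∧ ∀ M' : DirectMechanism n, M'.IsAdmissible D X →
    M'.expectedResidualSurplus D c ≤ M.expectedResidualSurplus D c

end DirectMechanism

/-- The ironed virtual surplus `∑ᵢ ϑ̄ᵢ(vᵢ) xᵢ - c(x)` of the allocation `x` at the profile `v`. -/
def ironedVirtualSurplus {n : ℕ} (D : Fin n → ValuationDist) (c : Allocation n → ℝ)
    (v : Fin n → ℝ) (x : Allocation n) : ℝ :=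
  ∑ i, (D i).ironed (v i) * x.entry i - c x

end MoneyBurning

end

/-!
Incentive compatibility says that an agent's interim allocation `xᵢ` selects subgradients of its
interim utility `uᵢ`, and individual rationality with nonnegative payments gives `uᵢ(0) = 0`. So
`uᵢ(z) = ∫₀ᶻ xᵢ`, and by Fubini the expected utility of the agent is `E[ϑᵢ xᵢ]`.

In the quantile `q = Fᵢ(z)`, which is uniformly distributed, the integrals of `ϑᵢ` and `ϑ̄ᵢ` up to
`z` are `Hᵢ(q)` and `Gᵢ(q)`. The two functions agree at `q = 0` and `q = 1`, so `ϑᵢ - ϑ̄ᵢ` has the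
tail integrals `Gᵢ - Hᵢ ≤ 0`. The superlevel sets of the monotone rule `xᵢ` are tails, hence the
layer cake formula yields `E[ϑᵢ xᵢ] ≤ E[ϑ̄ᵢ xᵢ]`. Where `Gᵢ < Hᵢ` the hull `Gᵢ` is locally affine
and `ϑ̄ᵢ` is locally constant; if `xᵢ` is constant there as well, then every threshold of `xᵢ` lies
where `Gᵢ = Hᵢ`, and the inequality is an equality.

The expected residual surplus of every mechanism is thus at most its expected ironed virtual
surplus, with equality for a mechanism satisfying the second condition, and the first condition
maximizes the ironed virtual surplus pointwise.
-/

namespace MoneyBurning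

open Set Filter Topology ProbabilityTheory

section ConvexMinorant

/-- The largest convex function on `s` below `H`, which is the hull `G` of the ironing procedure.
If no convex function lies below `H` on `s`, it takes the junk value `0`. -/
noncomputable def convexMinorant {E : Type*} [AddCommMonoid E] [Module ℝ E] (H : E → ℝ)
    (s : Set E) (q : E) : ℝ :=
  sSup {y | ∃ φ : E → ℝ, ConvexOn ℝ s φ ∧ (∀ r ∈ s, φ r ≤ H r) ∧ y = φ q}

section Module

variable {E : Type*} [AddCommMonoid E] [Module ℝ E] {H φ : E → ℝ} {s : Set E} {q : E}

theorem le_convexMinorant (hφ : ConvexOn ℝ s φ) (hφH : ∀ r ∈ s, φ r ≤ H r) (hq : q ∈ s) :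
    φ q ≤ convexMinorant H s q := by
  refine le_csSup ⟨H q, ?_⟩ ⟨φ, hφ, hφH, rfl⟩
  rintro _ ⟨ψ, -, hψH, rfl⟩
  exact hψH q hq

theorem exists_convexOn_le (hs : Convex ℝ s) (hH : BddBelow (H '' s)) :
    ∃ φ : E → ℝ, ConvexOn ℝ s φ ∧ ∀ r ∈ s, φ r ≤ H r := by
  obtain ⟨m, hm⟩ := hH
  exact ⟨fun _ => m, convexOn_const m hs, fun r hr => hm (mem_image_of_mem H hr)⟩

theorem convexMinorant_le_of_forall (hs : Convex ℝ s) (hH : BddBelow (H '' s)) {y : ℝ}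
    (hy : ∀ φ : E → ℝ, ConvexOn ℝ s φ → (∀ r ∈ s, φ r ≤ H r) → φ q ≤ y) :
    convexMinorant H s q ≤ y := by
  obtain ⟨φ₀, hφ₀, hφ₀H⟩ := exists_convexOn_le hs hH
  refine csSup_le ⟨_, φ₀, hφ₀, hφ₀H, rfl⟩ ?_
  rintro _ ⟨φ, hφ, hφH, rfl⟩
  exact hy φ hφ hφH

theorem convexMinorant_le (hs : Convex ℝ s) (hH : BddBelow (H '' s)) (hq : q ∈ s) :
    convexMinorant H s q ≤ H q :=
  convexMinorant_le_of_forall hs hH fun _ _ hφH => hφH q hq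

theorem convexOn_convexMinorant (hs : Convex ℝ s) (hH : BddBelow (H '' s)) :
    ConvexOn ℝ s (convexMinorant H s) := by
  refine ⟨hs, fun x hx y hy a b ha hb hab => convexMinorant_le_of_forall hs hH fun φ hφ hφH => ?_⟩
  calc φ (a • x + b • y) ≤ a • φ x + b • φ y := hφ.2 hx hy ha hb hab
    _ ≤ a • convexMinorant H s x + b • convexMinorant H s y := by
        gcongr
        · exact le_convexMinorant hφ hφH hx
        · exact le_convexMinorant hφ hφH hy

end Module

theorem exists_sub_mul_dist_le {α : Type*} [PseudoMetricSpace α] {H : α → ℝ} {s : Set α} {e : α}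
    (he : e ∈ s) (hH : BddBelow (H '' s)) (hHe : ContinuousWithinAt H s e) {a : ℝ} (ha : a < H e) :
    ∃ C, 0 ≤ C ∧ ∀ r ∈ s, a - C * dist r e ≤ H r := by
  obtain ⟨m, hm⟩ := hH
  have hm' : ∀ r ∈ s, m ≤ H r := fun r hr => hm (mem_image_of_mem H hr)
  obtain ⟨δ, hδ, hnear⟩ := Metric.mem_nhdsWithin_iff.1 (hHe.eventually (lt_mem_nhds ha))
  have hC : 0 ≤ (H e - m) / δ := div_nonneg (sub_nonneg.2 (hm' e he)) hδ.le
  refine ⟨(H e - m) / δ, hC, fun r hr => ?_⟩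
  rcases lt_or_ge (dist r e) δ with hclose | hfar
  · have : a < H r := hnear ⟨hclose, hr⟩
    linarith [mul_nonneg hC (dist_nonneg (x := r) (y := e))]
  · have : H e - m ≤ (H e - m) / δ * dist r e :=
      (div_mul_cancel₀ _ hδ.ne').symm.trans_le (mul_le_mul_of_nonneg_left hfar hC)
    linarith [hm' r hr]

section Extreme

variable {E : Type*} [SeminormedAddCommGroup E] [NormedSpace ℝ E] {H : E → ℝ} {s : Set E} {e : E}

/-- Concavity of `dist · e` makes the cones `a - C * dist · e` convex on `s`. -/
theorem exists_sub_mul_dist_le_convexMinorant (hdist : ConcaveOn ℝ s fun r => dist r e)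
    (he : e ∈ s) (hH : BddBelow (H '' s)) (hHe : ContinuousWithinAt H s e) {a : ℝ} (ha : a < H e) :
    ∃ C, ∀ r ∈ s, a - C * dist r e ≤ convexMinorant H s r := by
  obtain ⟨C, hC, hle⟩ := exists_sub_mul_dist_le he hH hHe ha
  exact ⟨C, fun r hr => le_convexMinorant ((convexOn_const a hdist.1).sub (hdist.smul hC)) hle hr⟩

theorem convexMinorant_eq_of_concaveOn_dist (hdist : ConcaveOn ℝ s fun r => dist r e) (he : e ∈ s)
    (hH : BddBelow (H '' s)) (hHe : ContinuousWithinAt H s e) :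
    convexMinorant H s e = H e := by
  refine (convexMinorant_le hdist.1 hH he).antisymm ?_
  refine le_of_forall_lt_imp_le_of_dense fun a ha => ?_
  obtain ⟨C, hC⟩ := exists_sub_mul_dist_le_convexMinorant hdist he hH hHe ha
  simpa using hC e he

theorem continuousWithinAt_convexMinorant_of_concaveOn_dist
    (hdist : ConcaveOn ℝ s fun r => dist r e) (he : e ∈ s)
    (hH : BddBelow (H '' s)) (hHe : ContinuousWithinAt H s e) :
    ContinuousWithinAt (convexMinorant H s) s e := by
  rw [ContinuousWithinAt, convexMinorant_eq_of_concaveOn_dist hdist he hH hHe]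
  refine tendsto_order.2 ⟨fun a ha => ?_, fun a ha => ?_⟩
  · obtain ⟨a', haa', ha'⟩ := exists_between ha
    obtain ⟨C, hC⟩ := exists_sub_mul_dist_le_convexMinorant hdist he hH hHe ha'
    have hcone : ContinuousWithinAt (fun r => a' - C * dist r e) s e := by fun_prop
    filter_upwards [hcone.eventually (lt_mem_nhds (by simpa using haa')), self_mem_nhdsWithin]
      with r har hr using har.trans_le (hC r hr)
  · filter_upwards [hHe.eventually (gt_mem_nhds ha), self_mem_nhdsWithin]
      with r hra hr using (convexMinorant_le hdist.1 hH hr).trans_lt hra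

end Extreme

section Interval

variable {H : ℝ → ℝ} {a b : ℝ}

theorem concaveOn_dist_left : ConcaveOn ℝ (Icc a b) fun r => dist r a :=
  ((concaveOn_id (convex_Icc a b)).sub (convexOn_const a (convex_Icc a b))).congr
    fun _ hr => by simp [Real.dist_eq, abs_of_nonneg (sub_nonneg.2 hr.1)]

theorem concaveOn_dist_right : ConcaveOn ℝ (Icc a b) fun r => dist r b :=
  ((concaveOn_const b (convex_Icc a b)).sub (convexOn_id (convex_Icc a b))).congr
    fun _ hr => by simp [Real.dist_eq, abs_sub_comm, abs_of_nonneg (sub_nonneg.2 hr.2)]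

theorem convexMinorant_left (hab : a ≤ b) (hH : ContinuousOn H (Icc a b)) :
    convexMinorant H (Icc a b) a = H a :=
  convexMinorant_eq_of_concaveOn_dist concaveOn_dist_left (left_mem_Icc.2 hab)
    (isCompact_Icc.bddBelow_image hH) (hH a (left_mem_Icc.2 hab))

theorem convexMinorant_right (hab : a ≤ b) (hH : ContinuousOn H (Icc a b)) :
    convexMinorant H (Icc a b) b = H b :=
  convexMinorant_eq_of_concaveOn_dist concaveOn_dist_right (right_mem_Icc.2 hab)
    (isCompact_Icc.bddBelow_image hH) (hH b (right_mem_Icc.2 hab))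

theorem continuousOn_convexMinorant (hH : ContinuousOn H (Icc a b)) :
    ContinuousOn (convexMinorant H (Icc a b)) (Icc a b) := by
  have hbdd := isCompact_Icc.bddBelow_image hH
  intro q hq
  rcases eq_or_lt_of_le hq.1 with rfl | haq
  · exact continuousWithinAt_convexMinorant_of_concaveOn_dist concaveOn_dist_left hq hbdd (hH _ hq)
  rcases eq_or_lt_of_le hq.2 with rfl | hqb
  · exact continuousWithinAt_convexMinorant_of_concaveOn_dist concaveOn_dist_right hq hbdd (hH _ hq)
  have hinterior := (convexOn_convexMinorant (convex_Icc a b) hbdd).continuousOn_interior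
  rw [interior_Icc] at hinterior
  exact (hinterior.continuousAt (Ioo_mem_nhds haq hqb)).continuousWithinAt

end Interval

section Chord

variable {φ : ℝ → ℝ} {s : Set ℝ} {x y r : ℝ}

/-- The affine function through the points of the graph of `φ` above `x` and `y`. -/
noncomputable def chord (φ : ℝ → ℝ) (x y r : ℝ) : ℝ := φ x + slope φ x y * (r - x)

theorem chord_right (φ : ℝ → ℝ) (x r : ℝ) : chord φ x r r = φ r := by
  have := sub_smul_slope φ x r
  rw [smul_eq_mul, vsub_eq_sub] at this
  rw [chord]
  linarith

theorem convexOn_chord (hs : Convex ℝ s) : ConvexOn ℝ s (chord φ x y) := by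
  refine ⟨hs, fun p _ q _ a b _ _ hab => le_of_eq ?_⟩
  simp only [chord, smul_eq_mul]
  linear_combination (slope φ x y * x - φ x) * hab

theorem hasDerivAt_chord (φ : ℝ → ℝ) (x y r : ℝ) :
    HasDerivAt (chord φ x y) (slope φ x y) r :=
  ((((hasDerivAt_id r).sub_const x).const_mul (slope φ x y)).const_add (φ x)).congr_deriv
    (mul_one _)

theorem le_chord_of_convexOn (hφ : ConvexOn ℝ s φ) (hx : x ∈ s) (hy : y ∈ s) (hr : r ∈ Icc x y) :
    φ r ≤ chord φ x y r := by
  rcases eq_or_lt_of_le hr.1 with rfl | hxr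
  · simp [chord]
  have hrs : r ∈ s := hφ.1.ordConnected.out hx hy hr
  calc φ r = φ x + slope φ x r * (r - x) := (chord_right φ x r).symm
    _ ≤ φ x + slope φ x y * (r - x) := by
        have hslope := hφ.slope_mono hx ⟨hrs, hxr.ne'⟩ ⟨hy, (hxr.trans_le hr.2).ne'⟩ hr.2
        have := sub_pos.2 hxr
        gcongr

theorem chord_le_of_convexOn (hφ : ConvexOn ℝ s φ) (hx : x ∈ s) (hy : y ∈ s) (hxy : x < y)
    (hr : r ∈ s) (hrxy : r ∉ Icc x y) : chord φ x y r ≤ φ r := by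
  rw [← chord_right φ x r, chord, chord, add_le_add_iff_left]
  rcases lt_or_ge r x with hrx | hxr
  · have hslope := hφ.slope_mono hx ⟨hr, hrx.ne⟩ ⟨hy, hxy.ne'⟩ (hrx.trans hxy).le
    exact mul_le_mul_of_nonpos_right hslope (sub_nonpos.2 hrx.le)
  · have hyr : y < r := not_le.1 fun hry => hrxy ⟨hxr, hry⟩
    have hslope := hφ.slope_mono hx ⟨hy, hxy.ne'⟩ ⟨hr, (hxy.trans hyr).ne'⟩ hyr.le
    exact mul_le_mul_of_nonneg_right hslope (sub_nonneg.2 hxr)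

theorem chord_le_of_le {m : ℝ} (hx : φ x ≤ m) (hy : φ y ≤ m) (hr : r ∈ Icc x y) :
    chord φ x y r ≤ m := by
  have hle := (convexOn_chord (φ := φ) (x := x) (y := y) (convex_Icc x y)).le_max_of_mem_Icc
    (left_mem_Icc.2 (hr.1.trans hr.2)) (right_mem_Icc.2 (hr.1.trans hr.2)) hr
  rw [chord_right φ x y, show chord φ x y x = φ x by simp [chord]] at hle
  exact hle.trans (max_le hx hy)

end Chord

/-- Otherwise a short chord of the minorant, which still lies below `H`, could be used to raise
the minorant near `q`. -/
theorem exists_convexMinorant_eventuallyEq_chord {H : ℝ → ℝ} {s : Set ℝ} {q : ℝ}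
    (hs : Convex ℝ s) (hH : BddBelow (H '' s)) (hq : q ∈ interior s) (hHq : ContinuousAt H q)
    (hlt : convexMinorant H s q < H q) :
    ∃ x y, convexMinorant H s =ᶠ[𝓝 q] chord (convexMinorant H s) x y := by
  set G := convexMinorant H s
  have hG : ConvexOn ℝ s G := convexOn_convexMinorant hs hH
  have hGq : ContinuousAt G q := hG.continuousOn_interior.continuousAt (isOpen_interior.mem_nhds hq)
  obtain ⟨m, hGm, hmH⟩ := exists_between hlt
  have hsep : ∀ᶠ r in 𝓝 q, G r < m ∧ m < H r ∧ r ∈ s :=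
    (hGq.eventually (gt_mem_nhds hGm)).and
      ((hHq.eventually (lt_mem_nhds hmH)).and (mem_interior_iff_mem_nhds.1 hq))
  obtain ⟨δ, hδ, hball⟩ := Metric.nhds_basis_closedBall.eventually_iff.1 hsep
  rw [Real.closedBall_eq_Icc] at hball
  have hxy : q - δ < q + δ := by linarith
  obtain ⟨hGx, -, hx⟩ := hball (left_mem_Icc.2 hxy.le)
  obtain ⟨hGy, -, hy⟩ := hball (right_mem_Icc.2 hxy.le)
  have hchordH : ∀ r ∈ s, chord G (q - δ) (q + δ) r ≤ H r := by
    intro r hr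
    by_cases hrxy : r ∈ Icc (q - δ) (q + δ)
    · exact (chord_le_of_le hGx.le hGy.le hrxy).trans (hball hrxy).2.1.le
    · exact (chord_le_of_convexOn hG hx hy hxy hr hrxy).trans (convexMinorant_le hs hH hr)
  refine ⟨q - δ, q + δ, ?_⟩
  filter_upwards [Icc_mem_nhds (sub_lt_self q hδ) (lt_add_of_pos_right q hδ)] with r hr
  exact le_antisymm (le_chord_of_convexOn hG hx hy hr)
    (le_convexMinorant (convexOn_chord hs) hchordH (hball hr).2.2)

theorem eventuallyConst_derivWithin_Ioi_convexMinorant {H : ℝ → ℝ} {s : Set ℝ} {q : ℝ}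
    (hs : Convex ℝ s) (hH : BddBelow (H '' s)) (hq : q ∈ interior s) (hHq : ContinuousAt H q)
    (hlt : convexMinorant H s q < H q) :
    EventuallyConst (fun r => derivWithin (convexMinorant H s) (Ioi r) r) (𝓝 q) := by
  obtain ⟨x, y, hchord⟩ := exists_convexMinorant_eventuallyEq_chord hs hH hq hHq hlt
  refine eventuallyConst_iff_exists_eventuallyEq.2 ⟨slope (convexMinorant H s) x y, ?_⟩
  filter_upwards [hchord.eventually_nhds] with r hr
  exact ((hasDerivAt_chord _ x y r).congr_of_eventuallyEq hr).hasDerivWithinAt.derivWithin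
    (uniqueDiffWithinAt_Ioi r)

end ConvexMinorant

theorem rightDeriv_nonneg_of_isMinOn_left {φ : ℝ → ℝ} {a b q : ℝ} (hφ : ConvexOn ℝ (Icc a b) φ)
    (hmin : IsMinOn φ (Icc a b) a) (hq : q ∈ Ioo a b) : 0 ≤ derivWithin φ (Ioi q) q := by
  have hqI : q ∈ Icc a b := Ioo_subset_Icc_self hq
  have hqi : q ∈ interior (Icc a b) := by rwa [interior_Icc]
  calc 0 ≤ slope φ a q := by
        rw [slope_def_field]
        exact div_nonneg (sub_nonneg.2 (hmin hqI)) (sub_nonneg.2 hq.1.le)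
    _ ≤ derivWithin φ (Iio q) q :=
        hφ.slope_le_leftDeriv_of_mem_interior (left_mem_Icc.2 (hqI.1.trans hqI.2)) hqi hq.1
    _ ≤ derivWithin φ (Ioi q) q := hφ.leftDeriv_le_rightDeriv_of_mem_interior hqi

theorem eventuallyConst_nhds_iff_hasDerivAt_zero {x : ℝ → ℝ} {a : ℝ} :
    EventuallyConst x (𝓝 a) ↔ ∀ᶠ z in 𝓝 a, HasDerivAt x 0 z := by
  rw [eventuallyConst_iff_exists_eventuallyEq]
  refine ⟨fun ⟨s, hs⟩ => ?_, fun h => ⟨x a, ?_⟩⟩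
  · filter_upwards [hs.eventually_nhds] with z hz
    exact (hasDerivAt_const z s).congr_of_eventuallyEq hz
  · obtain ⟨ε, hε, hball⟩ := Metric.eventually_nhds_iff_ball.1 h
    filter_upwards [Metric.ball_mem_nhds a hε] with z hz
    exact Metric.isOpen_ball.is_const_of_deriv_eq_zero (convex_ball a ε).isPreconnected
      (fun w hw => (hball w hw).differentiableAt.differentiableWithinAt)
      (fun w hw => (hball w hw).deriv) hz (Metric.mem_ball_self hε)

section CdfTransform

variable (μ : Measure ℝ) [IsProbabilityMeasure μ] [NullSingletonClass μ]

theorem continuous_cdf : Continuous (cdf μ) := by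
  refine continuous_iff_continuousAt.2 fun z =>
    (monotone_cdf μ).continuousAt_iff_leftLim_eq_rightLim.2 ?_
  have hatom : (cdf μ).measure {z} = 0 := by rw [measure_cdf, measure_singleton]
  rw [StieltjesFunction.measure_singleton, ENNReal.ofReal_eq_zero] at hatom
  rw [StieltjesFunction.rightLim_eq]
  exact le_antisymm ((monotone_cdf μ).leftLim_le le_rfl) (sub_nonpos.1 hatom)

theorem Ioo_subset_range_cdf : Ioo 0 1 ⊆ range (cdf μ) := fun _ hq =>
  mem_range_of_exists_le_of_exists_ge (continuous_cdf μ)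
    ((tendsto_cdf_atBot μ).eventually (ge_mem_nhds hq.1)).exists
    ((tendsto_cdf_atTop μ).eventually (le_mem_nhds hq.2)).exists

theorem preimage_cdf_Iic_ae_eq (z : ℝ) : cdf μ ⁻¹' Iic (cdf μ z) =ᵐ[μ] Iic z := by
  set A := cdf μ ⁻¹' Iic (cdf μ z)
  suffices hle : μ A ≤ μ (Iic z) from
    (ae_eq_of_subset_of_measure_ge (fun _ hw => monotone_cdf μ hw) hle
      measurableSet_Iic.nullMeasurableSet (measure_ne_top _ _)).symm
  by_cases hbdd : BddAbove A
  · have hsup : sSup A ∈ A :=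
      (isClosed_Iic.preimage (continuous_cdf μ)).csSup_mem ⟨z, le_refl (cdf μ z)⟩ hbdd
    calc μ A ≤ μ (Iic (sSup A)) := measure_mono fun w hw => le_csSup hbdd hw
      _ ≤ μ (Iic z) := by
          rw [← ofReal_cdf, ← ofReal_cdf]
          exact ENNReal.ofReal_le_ofReal hsup
  · have hle : ∀ w, cdf μ w ≤ cdf μ z := fun w => by
      obtain ⟨y, hy, hwy⟩ := not_bddAbove_iff.1 hbdd w
      exact (monotone_cdf μ hwy.le).trans hy
    calc μ A ≤ ENNReal.ofReal 1 := by simpa using prob_le_one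
      _ ≤ μ (Iic z) := by
          rw [← ofReal_cdf]
          exact ENNReal.ofReal_le_ofReal (le_of_tendsto' (tendsto_cdf_atTop μ) hle)

theorem measure_preimage_cdf_Iic {q : ℝ} (hq : q ∈ Icc 0 1) :
    μ (cdf μ ⁻¹' Iic q) = ENNReal.ofReal q := by
  by_cases hrange : q ∈ range (cdf μ)
  · obtain ⟨z, rfl⟩ := hrange
    rw [measure_congr (preimage_cdf_Iic_ae_eq μ z), ofReal_cdf]
  rcases eq_endpoints_or_mem_Ioo_of_mem_Icc hq with rfl | rfl | hq
  · have hempty : cdf μ ⁻¹' Iic 0 = ∅ := eq_empty_of_forall_notMem fun z hz =>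
      hrange ⟨z, hz.antisymm (cdf_nonneg μ z)⟩
    simp [hempty]
  · have huniv : cdf μ ⁻¹' Iic 1 = univ := eq_univ_of_forall (cdf_le_one μ)
    simp [huniv]
  · exact absurd (Ioo_subset_range_cdf μ hq) hrange

theorem map_cdf_eq_volume_restrict_Ioc : μ.map (cdf μ) = volume.restrict (Ioc 0 1) := by
  have hmeas : Measurable (cdf μ) := (monotone_cdf μ).measurable
  have : IsProbabilityMeasure (μ.map (cdf μ)) :=
    Measure.isProbabilityMeasure_map hmeas.aemeasurable
  refine Measure.ext_of_Iic _ _ fun q => ?_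
  have hclamp : cdf μ ⁻¹' Iic q = cdf μ ⁻¹' Iic (min q 1) := by
    ext z
    simp [cdf_le_one]
  rw [Measure.map_apply hmeas measurableSet_Iic, Measure.restrict_apply measurableSet_Iic,
    inter_comm, Ioc_inter_Iic, inf_comm, Real.volume_Ioc, sub_zero, hclamp]
  rcases lt_or_ge q 0 with hq | hq
  · have hempty : cdf μ ⁻¹' Iic (min q 1) = ∅ := eq_empty_of_forall_notMem fun z hz =>
      ((cdf_nonneg μ z).trans hz).not_gt (min_lt_of_left_lt hq)
    simp [hempty, ENNReal.ofReal_of_nonpos, hq.le]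
  · exact measure_preimage_cdf_Iic μ ⟨le_min hq zero_le_one, min_le_right _ _⟩

variable {μ}

theorem integrableOn_Ioc_iff_integrable_comp_cdf {φ : ℝ → ℝ}
    (hφ : AEStronglyMeasurable φ (volume.restrict (Ioc 0 1))) :
    IntegrableOn φ (Ioc 0 1) ↔ Integrable (fun z => φ (cdf μ z)) μ := by
  rw [← map_cdf_eq_volume_restrict_Ioc μ] at hφ
  rw [IntegrableOn, ← map_cdf_eq_volume_restrict_Ioc μ,
    integrable_map_measure hφ (monotone_cdf μ).measurable.aemeasurable]
  rfl

theorem intervalIntegral_cdf_eq {φ : ℝ → ℝ}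
    (hφ : AEStronglyMeasurable φ (volume.restrict (Ioc 0 1))) (z : ℝ) :
    ∫ q in (0 : ℝ)..cdf μ z, φ q = ∫ w in Iic z, φ (cdf μ w) ∂μ := by
  have hIoc : Ioc 0 (cdf μ z) = Iic (cdf μ z) ∩ Ioc 0 1 := by
    rw [inter_comm, Ioc_inter_Iic, inf_eq_right.2 (cdf_le_one μ z)]
  rw [← map_cdf_eq_volume_restrict_Ioc μ] at hφ
  rw [intervalIntegral.integral_of_le (cdf_nonneg μ z), hIoc,
    ← Measure.restrict_restrict measurableSet_Iic, ← map_cdf_eq_volume_restrict_Ioc μ,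
    setIntegral_map measurableSet_Iic hφ (monotone_cdf μ).measurable.aemeasurable]
  exact setIntegral_congr_set (preimage_cdf_Iic_ae_eq μ z)

end CdfTransform

section MonotoneWeight

theorem integrable_mul_of_mem_Icc {α : Type*} [MeasurableSpace α] {μ : Measure α} {ψ x : α → ℝ}
    (hψ : Integrable ψ μ) (hx : Measurable x) (hx01 : ∀ z, x z ∈ Icc 0 1) :
    Integrable (fun z => ψ z * x z) μ :=
  hψ.mul_bdd (c := 1) hx.aestronglyMeasurable <| ae_of_all _ fun z => by
    rw [Real.norm_eq_abs, abs_of_nonneg (hx01 z).1]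
    exact (hx01 z).2

theorem integral_mul_eq_integral_superlevel {α : Type*} [MeasurableSpace α] {μ : Measure α}
    [SFinite μ] {ψ x : α → ℝ} (hψ : Integrable ψ μ) (hx : Measurable x)
    (hx01 : ∀ z, x z ∈ Icc 0 1) :
    ∫ z, ψ z * x z ∂μ = ∫ t in Ioc (0 : ℝ) 1, ∫ z in {z | t < x z}, ψ z ∂μ := by
  set S : Set (α × ℝ) := {p | p.2 < x p.1}
  have hS : MeasurableSet S := measurableSet_lt measurable_snd (hx.comp measurable_fst)
  have hlayer : ∀ z, ψ z * x z = ∫ t in Ioc (0 : ℝ) 1, S.indicator (fun p => ψ p.1) (z, t) := by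
    intro z
    have hIoo : Iio (x z) ∩ Ioc 0 1 = Ioo 0 (x z) := by
      ext t
      exact ⟨fun h => ⟨h.2.1, h.1⟩, fun h => ⟨h.2, h.1, h.2.le.trans (hx01 z).2⟩⟩
    calc ψ z * x z = ∫ _ in Ioo 0 (x z), ψ z := by
          rw [setIntegral_const, Real.volume_real_Ioo_of_le (hx01 z).1, sub_zero, smul_eq_mul,
            mul_comm]
      _ = ∫ t in Ioc (0 : ℝ) 1, (Iio (x z)).indicator (fun _ => ψ z) t := by
          rw [integral_indicator measurableSet_Iio, Measure.restrict_restrict measurableSet_Iio,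
            hIoo]
  calc ∫ z, ψ z * x z ∂μ
      = ∫ z, (∫ t in Ioc (0 : ℝ) 1, S.indicator (fun p => ψ p.1) (z, t)) ∂μ := by
        simp_rw [hlayer]
    _ = ∫ t in Ioc (0 : ℝ) 1, ∫ z, S.indicator (fun p => ψ p.1) (z, t) ∂μ :=
        integral_integral_swap ((hψ.comp_fst _).indicator hS)
    _ = ∫ t in Ioc (0 : ℝ) 1, ∫ z in {z | t < x z}, ψ z ∂μ := by
        simp_rw [← integral_indicator (measurableSet_lt measurable_const hx)]
        rfl

variable {μ : Measure ℝ} {ψ x : ℝ → ℝ} {a b : ℝ}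

theorem exists_threshold_of_monotoneOn (hab : a ≤ b) (hx : MonotoneOn x (Icc a b)) (t : ℝ) :
    ∃ c ∈ Icc a b, (∀ z ∈ Icc a b, z < c → x z ≤ t) ∧ ∀ z ∈ Icc a b, c < z → t < x z := by
  set S := insert b {z ∈ Icc a b | t < x z}
  have hS : S ⊆ Icc a b := insert_subset (right_mem_Icc.2 hab) (sep_subset _ _)
  have hbdd : BddBelow S := bddBelow_Icc.mono hS
  refine ⟨sInf S, ⟨le_csInf ⟨b, mem_insert b _⟩ fun z hz => (hS hz).1,
    csInf_le hbdd (mem_insert b _)⟩, fun z hz hzc => ?_, fun z hz hcz => ?_⟩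
  · by_contra! htz
    exact hzc.not_ge (csInf_le hbdd (mem_insert_of_mem _ ⟨hz, htz⟩))
  · obtain ⟨w, rfl | hw, hwz⟩ := exists_lt_of_csInf_lt ⟨b, mem_insert b _⟩ hcz
    · exact absurd hz.2 hwz.not_ge
    · exact hw.2.trans_le (hx hw.1 hz hwz.le)

variable [NullSingletonClass μ]

theorem superlevel_ae_eq_Ioi {c t : ℝ} (hμ : ∀ᵐ z ∂μ, z ∈ Icc a b)
    (hlow : ∀ z ∈ Icc a b, z < c → x z ≤ t) (hhigh : ∀ z ∈ Icc a b, c < z → t < x z) :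
    {z | t < x z} =ᵐ[μ] Ioi c := by
  filter_upwards [hμ, Measure.ae_ne μ c] with z hz hzc
  refine propext ⟨fun htz => ?_, hhigh z hz⟩
  exact (not_lt.1 fun hzc => htz.not_ge (hlow z hz hzc)).lt_of_ne' hzc

theorem integral_mul_nonpos_of_setIntegral_Ioi_nonpos [SFinite μ] (hab : a ≤ b)
    (hμ : ∀ᵐ z ∂μ, z ∈ Icc a b) (hψ : Integrable ψ μ)
    (htail : ∀ c ∈ Icc a b, ∫ z in Ioi c, ψ z ∂μ ≤ 0) (hxm : Measurable x)
    (hx01 : ∀ z, x z ∈ Icc 0 1) (hx : MonotoneOn x (Icc a b)) :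
    ∫ z, ψ z * x z ∂μ ≤ 0 := by
  rw [integral_mul_eq_integral_superlevel hψ hxm hx01]
  refine integral_nonpos fun t => ?_
  obtain ⟨c, hc, hlow, hhigh⟩ := exists_threshold_of_monotoneOn hab hx t
  exact (setIntegral_congr_set (superlevel_ae_eq_Ioi hμ hlow hhigh)).trans_le (htail c hc)

theorem not_eventuallyConst_of_threshold {c t : ℝ} (hc : c ∈ Ioo a b)
    (hlow : ∀ z ∈ Icc a b, z < c → x z ≤ t) (hhigh : ∀ z ∈ Icc a b, c < z → t < x z) :
    ¬ EventuallyConst x (𝓝 c) := by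
  intro hconst
  obtain ⟨s, hs⟩ := eventuallyConst_iff_exists_eventuallyEq.1 hconst
  have hnear : ∀ᶠ z in 𝓝 c, x z = s ∧ z ∈ Icc a b := hs.and (Icc_mem_nhds hc.1 hc.2)
  obtain ⟨z, ⟨hxz, hz⟩, hzc⟩ :=
    ((hnear.filter_mono nhdsWithin_le_nhds).and (eventually_mem_nhdsWithin (s := Iio c))).exists
  obtain ⟨w, ⟨hxw, hw⟩, hcw⟩ :=
    ((hnear.filter_mono nhdsWithin_le_nhds).and (eventually_mem_nhdsWithin (s := Ioi c))).exists
  have hst : s ≤ t := hxz ▸ hlow z hz hzc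
  have hts : t < s := hxw ▸ hhigh w hw hcw
  exact hts.not_ge hst

theorem integral_mul_eq_zero_of_eventuallyConst [SFinite μ] (hab : a ≤ b)
    (hμ : ∀ᵐ z ∂μ, z ∈ Icc a b) (hψ : Integrable ψ μ) (hψ0 : ∫ z, ψ z ∂μ = 0)
    (hxm : Measurable x) (hx01 : ∀ z, x z ∈ Icc 0 1) (hx : MonotoneOn x (Icc a b))
    (hconst : ∀ c ∈ Ioo a b, ∫ z in Ioi c, ψ z ∂μ ≠ 0 → EventuallyConst x (𝓝 c)) :
    ∫ z, ψ z * x z ∂μ = 0 := by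
  rw [integral_mul_eq_integral_superlevel hψ hxm hx01]
  refine integral_eq_zero_of_ae (ae_of_all _ fun t => ?_)
  obtain ⟨c, hc, hlow, hhigh⟩ := exists_threshold_of_monotoneOn hab hx t
  refine (setIntegral_congr_set (superlevel_ae_eq_Ioi hμ hlow hhigh)).trans ?_
  rcases eq_endpoints_or_mem_Ioo_of_mem_Icc hc with rfl | rfl | hc
  · have huniv : ∀ᵐ z ∂μ, z ∈ Ioi c := by
      filter_upwards [hμ, Measure.ae_ne μ c] with z hz hzc using hz.1.lt_of_ne' hzc
    rw [Measure.restrict_eq_self_of_ae_mem huniv, hψ0, Pi.zero_apply]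
  · have hnull : μ (Ioi c) = 0 :=
      measure_mono_null (fun z (hz : c < z) (h : z ∈ Icc a c) => hz.not_ge h.2) hμ
    rw [Measure.restrict_eq_zero.2 hnull, integral_zero_measure, Pi.zero_apply]
  · by_contra hne
    exact not_eventuallyConst_of_threshold hc hlow hhigh (hconst c hc hne)

end MonotoneWeight

/-- `x` selects subgradients of `u` on `s`. Bayesian incentive compatibility says that the interim
allocation selects subgradients of the interim utility. -/
def IsSubgradientOn (x u : ℝ → ℝ) (s : Set ℝ) : Prop :=
  ∀ z ∈ s, ∀ w ∈ s, (w - z) * x z ≤ u w - u z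

namespace IsSubgradientOn

variable {x u : ℝ → ℝ} {s t : Set ℝ} {a b : ℝ}

theorem mono (h : IsSubgradientOn x u s) (hts : t ⊆ s) : IsSubgradientOn x u t :=
  fun z hz w hw => h z (hts hz) w (hts hw)

theorem sub_le (h : IsSubgradientOn x u s) {z w : ℝ} (hz : z ∈ s) (hw : w ∈ s) :
    u w - u z ≤ (w - z) * x w := by
  linarith [h w hw z hz]

theorem monotoneOn (h : IsSubgradientOn x u s) : MonotoneOn x s := by
  intro z hz w hw hzw
  rcases hzw.eq_or_lt with rfl | hzw
  · exact le_rfl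
  · exact le_of_mul_le_mul_left ((h z hz w hw).trans (h.sub_le hz hw)) (sub_pos.2 hzw)

theorem continuousOn_Icc (h : IsSubgradientOn x u (Icc a b)) : ContinuousOn u (Icc a b) := by
  set K := max |x a| |x b|
  have hK : ∀ z ∈ Icc a b, |x z| ≤ K := fun z hz =>
    abs_le_max_abs_abs (h.monotoneOn (left_mem_Icc.2 (hz.1.trans hz.2)) hz hz.1)
      (h.monotoneOn hz (right_mem_Icc.2 (hz.1.trans hz.2)) hz.2)
  have hlip : LipschitzOnWith K.toNNReal u (Icc a b) := by
    refine LipschitzOnWith.of_le_add_mul _ fun z hz w hw => ?_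
    rw [← sub_le_iff_le_add', Real.coe_toNNReal _ ((abs_nonneg _).trans (hK z hz)), Real.dist_eq]
    calc u z - u w ≤ (z - w) * x z := h.sub_le hw hz
      _ ≤ |x z| * |z - w| := by rw [← abs_mul, mul_comm]; exact le_abs_self _
      _ ≤ K * |z - w| := by gcongr; exact hK z hz
  exact hlip.continuousOn

theorem hasDerivWithinAt (h : IsSubgradientOn x u s) {z : ℝ} (hz : z ∈ s)
    (hx : ContinuousWithinAt x s z) : HasDerivWithinAt u (x z) s z := by
  refine .of_isLittleO <| Asymptotics.isLittleO_iff.2 fun ε hε => ?_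
  filter_upwards [Metric.continuousWithinAt_iff'.1 hx ε hε, self_mem_nhdsWithin] with w hwε hw
  have hlow := h z hz w hw
  have hupp := h.sub_le hz hw
  rw [Real.dist_eq] at hwε
  rw [Real.norm_eq_abs, Real.norm_eq_abs, smul_eq_mul, abs_of_nonneg (sub_nonneg.2 hlow)]
  calc u w - u z - (w - z) * x z ≤ (x w - x z) * (w - z) := by linarith
    _ ≤ |x w - x z| * |w - z| := by rw [← abs_mul]; exact le_abs_self _
    _ ≤ ε * |w - z| := by gcongr

theorem integral_eq_sub (h : IsSubgradientOn x u (Icc a b)) (hab : a ≤ b) :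
    ∫ z in a..b, x z = u b - u a := by
  refine integral_eq_of_hasDerivAt_off_countable_of_le u x hab
    h.monotoneOn.countable_not_continuousWithinAt h.continuousOn_Icc ?_ ?_
  · rintro z ⟨hz, hzdisc⟩
    have hzI : z ∈ Icc a b := Ioo_subset_Icc_self hz
    have hcont : ContinuousWithinAt x (Icc a b) z := by
      by_contra hdisc
      exact hzdisc ⟨hzI, hdisc⟩
    exact (h.hasDerivWithinAt hzI hcont).hasDerivAt (Icc_mem_nhds hz.1 hz.2)
  · exact MonotoneOn.intervalIntegrable (by rw [uIcc_of_le hab]; exact h.monotoneOn)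

end IsSubgradientOn

theorem integral_intervalIntegral_eq {μ : Measure ℝ} [IsProbabilityMeasure μ] {x : ℝ → ℝ}
    {a b : ℝ} (hab : a ≤ b) (hμ : ∀ᵐ z ∂μ, z ∈ Icc a b) (hx : IntegrableOn x (Ioc a b)) :
    ∫ z, (∫ w in a..z, x w) ∂μ = ∫ w in a..b, (1 - cdf μ w) * x w := by
  set S : Set (ℝ × ℝ) := {p | p.2 < p.1}
  have hS : MeasurableSet S := measurableSet_lt measurable_snd measurable_fst
  calc ∫ z, (∫ w in a..z, x w) ∂μ
      = ∫ z, (∫ w in Ioc a b, S.indicator (fun p => x p.2) (z, w)) ∂μ := by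
        refine integral_congr_ae (hμ.mono fun z hz => ?_)
        have hIoo : Iio z ∩ Ioc a b = Ioo a z := by
          ext w
          exact ⟨fun h => ⟨h.2.1, h.1⟩, fun h => ⟨h.2, h.1, h.2.le.trans hz.2⟩⟩
        calc ∫ w in a..z, x w = ∫ w in Ioo a z, x w := by
              rw [intervalIntegral.integral_of_le hz.1, integral_Ioc_eq_integral_Ioo]
          _ = ∫ w in Ioc a b, (Iio z).indicator x w := by
              rw [integral_indicator measurableSet_Iio,
                Measure.restrict_restrict measurableSet_Iio, hIoo]
    _ = ∫ w in Ioc a b, ∫ z, S.indicator (fun p => x p.2) (z, w) ∂μ :=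
        integral_integral_swap ((Integrable.comp_snd hx μ).indicator hS)
    _ = ∫ w in Ioc a b, ∫ z, (Ioi w).indicator (fun _ => x w) z ∂μ := rfl
    _ = ∫ w in a..b, (1 - cdf μ w) * x w := by
        rw [intervalIntegral.integral_of_le hab]
        simp_rw [integral_indicator_const _ measurableSet_Ioi, ← compl_Iic,
          probReal_compl_eq_one_sub measurableSet_Iic, cdf_eq_real, smul_eq_mul]

namespace ValuationDist

variable (D : ValuationDist)

theorem law_absolutelyContinuous : D.law ≪ volume := withDensity_absolutelyContinuous _ _

instance : NullSingletonClass D.law :=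
  ⟨fun z => D.law_absolutelyContinuous (measure_singleton z)⟩

theorem f_nonneg (z : ℝ) : 0 ≤ D.f z := by
  by_cases hz : z ∈ Icc 0 D.b
  · exact (D.f_pos z hz).le
  · exact (D.f_zero z hz).ge

theorem ae_mem_Icc : ∀ᵐ z ∂D.law, z ∈ Icc 0 D.b := by
  rw [law, ae_withDensity_iff D.measurable_f.ennreal_ofReal]
  refine ae_of_all _ fun z hz => ?_
  by_contra hzI
  exact hz (by rw [D.f_zero z hzI, ENNReal.ofReal_zero])

theorem integrable_law_iff {φ : ℝ → ℝ} :
    Integrable φ D.law ↔ Integrable fun z => D.f z * φ z := by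
  rw [law, integrable_withDensity_iff_integrable_smul' D.measurable_f.ennreal_ofReal
    (ae_of_all _ fun _ => ENNReal.ofReal_lt_top)]
  simp only [ENNReal.toReal_ofReal (D.f_nonneg _), smul_eq_mul]

theorem integral_law (φ : ℝ → ℝ) : ∫ z, φ z ∂D.law = ∫ z, D.f z * φ z := by
  rw [law, integral_withDensity_eq_integral_toReal_smul D.measurable_f.ennreal_ofReal
    (ae_of_all _ fun _ => ENNReal.ofReal_lt_top)]
  simp only [ENNReal.toReal_ofReal (D.f_nonneg _), smul_eq_mul]

theorem integrable_id : Integrable (fun z => z) D.law :=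
  Integrable.of_mem_Icc 0 D.b aemeasurable_id D.ae_mem_Icc

theorem monotone_F : Monotone D.F := monotone_cdf D.law

theorem continuous_F : Continuous D.F := continuous_cdf D.law

theorem F_nonneg (z : ℝ) : 0 ≤ D.F z := cdf_nonneg D.law z

theorem F_le_one (z : ℝ) : D.F z ≤ 1 := cdf_le_one D.law z

theorem F_mem_Icc (z : ℝ) : D.F z ∈ Icc 0 1 := ⟨D.F_nonneg z, D.F_le_one z⟩

theorem F_zero : D.F 0 = 0 := by
  have hnull : D.law (Iio 0) = 0 :=
    measure_mono_null (fun z (hz : z < 0) (h : z ∈ Icc 0 D.b) => hz.not_ge h.1) D.ae_mem_Icc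
  rw [F, cdf_eq_real, measureReal_def, ← measure_congr Iio_ae_eq_Iic, hnull, ENNReal.toReal_zero]

theorem F_b : D.F D.b = 1 := by
  have hfull : D.law (Iic D.b) = 1 :=
    (mem_ae_iff_prob_eq_one measurableSet_Iic).1 (D.ae_mem_Icc.mono fun _ hz => hz.2)
  rw [F, cdf_eq_real, measureReal_def, hfull, ENNReal.toReal_one]

theorem strictMonoOn_F : StrictMonoOn D.F (Icc 0 D.b) := by
  intro z hz w hw hzw
  have hsupp : Ioc z w ⊆ Function.support fun y => ENNReal.ofReal (D.f y) := fun y hy => by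
    simpa using D.f_pos y ⟨hz.1.trans hy.1.le, hy.2.trans hw.2⟩
  have hpos : 0 < D.law (Ioc z w) := by
    rw [law, withDensity_apply _ measurableSet_Ioc,
      setLIntegral_pos_iff D.measurable_f.ennreal_ofReal, inter_eq_right.2 hsupp, Real.volume_Ioc]
    exact ENNReal.ofReal_pos.2 (sub_pos.2 hzw)
  rw [← measure_cdf D.law, StieltjesFunction.measure_Ioc, ENNReal.ofReal_pos] at hpos
  exact sub_pos.1 hpos

theorem F_mem_Ioo {z : ℝ} (hz : z ∈ Ioo 0 D.b) : D.F z ∈ Ioo 0 1 := by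
  rw [← D.F_zero, ← D.F_b]
  exact D.strictMonoOn_F.mapsTo_Ioo hz

theorem Finv_F {z : ℝ} (hz : z ∈ Icc 0 D.b) : D.Finv (D.F z) = z := by
  have hIcc : {w | w ∈ Icc 0 D.b ∧ D.F z ≤ D.F w} = Icc z D.b := by
    ext w
    exact ⟨fun h => ⟨(D.strictMonoOn_F.le_iff_le hz h.1).1 h.2, h.1.2⟩,
      fun h => ⟨⟨hz.1.trans h.1, h.2⟩, D.monotone_F h.1⟩⟩
  rw [Finv, hIcc, csInf_Icc hz.2]

theorem monotoneOn_Finv : MonotoneOn D.Finv (Icc 0 1) := fun _ _ _ hr hqr =>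
  csInf_le_csInf ⟨0, fun _ hz => hz.1.1⟩
    ⟨D.b, right_mem_Icc.2 D.b_pos.le, hr.2.trans_eq D.F_b.symm⟩
    fun _ hz => ⟨hz.1, hqr.trans hz.2⟩

section VirtualValue

theorem measurable_virtualValue : Measurable D.virtualValue :=
  (measurable_const.sub D.monotone_F.measurable).div D.measurable_f

theorem virtualValue_nonneg (z : ℝ) : 0 ≤ D.virtualValue z :=
  div_nonneg (sub_nonneg.2 (D.F_le_one z)) (D.f_nonneg z)

theorem f_mul_virtualValue (z : ℝ) :
    D.f z * D.virtualValue z = (Icc 0 D.b).indicator (fun z => 1 - D.F z) z := by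
  by_cases hz : z ∈ Icc 0 D.b
  · rw [indicator_of_mem hz, virtualValue, mul_div_cancel₀ _ (D.f_pos z hz).ne']
  · rw [indicator_of_notMem hz, D.f_zero z hz, zero_mul]

theorem integrable_virtualValue : Integrable D.virtualValue D.law := by
  simp_rw [integrable_law_iff, f_mul_virtualValue]
  rw [integrable_indicator_iff measurableSet_Icc]
  exact (continuous_const.sub D.continuous_F).continuousOn.integrableOn_Icc

theorem integral_virtualValue_mul_eq {x u : ℝ → ℝ} (hxu : IsSubgradientOn x u (Icc 0 D.b))
    (hu0 : u 0 = 0) : ∫ z, D.virtualValue z * x z ∂D.law = ∫ z, u z ∂D.law := by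
  have hx : IntegrableOn x (Ioc 0 D.b) :=
    (hxu.monotoneOn.integrableOn_isCompact isCompact_Icc).mono_set Ioc_subset_Icc_self
  have hu : ∀ z ∈ Icc 0 D.b, ∫ w in (0 : ℝ)..z, x w = u z := fun z hz => by
    rw [(hxu.mono (Icc_subset_Icc_right hz.2)).integral_eq_sub hz.1, hu0, sub_zero]
  calc ∫ z, D.virtualValue z * x z ∂D.law
      = ∫ z, (Icc 0 D.b).indicator (fun z => (1 - D.F z) * x z) z := by
        simp_rw [integral_law, ← mul_assoc, f_mul_virtualValue, indicator_mul_left]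
    _ = ∫ z in (0 : ℝ)..D.b, (1 - cdf D.law z) * x z := by
        rw [integral_indicator measurableSet_Icc, integral_Icc_eq_integral_Ioc,
          intervalIntegral.integral_of_le D.b_pos.le]
        rfl
    _ = ∫ z, (∫ w in (0 : ℝ)..z, x w) ∂D.law :=
        (integral_intervalIntegral_eq D.b_pos.le D.ae_mem_Icc hx).symm
    _ = ∫ z, u z ∂D.law := integral_congr_ae (D.ae_mem_Icc.mono hu)

end VirtualValue

section Ironing

theorem aestronglyMeasurable_h : AEStronglyMeasurable D.h (volume.restrict (Ioc 0 1)) :=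
  (D.measurable_virtualValue.comp_aemeasurable <| aemeasurable_restrict_of_monotoneOn
    measurableSet_Ioc <| D.monotoneOn_Finv.mono Ioc_subset_Icc_self).aestronglyMeasurable

theorem h_F_ae_eq : (fun z => D.h (D.F z)) =ᵐ[D.law] D.virtualValue := by
  filter_upwards [D.ae_mem_Icc] with z hz
  rw [h, D.Finv_F hz]

theorem integrableOn_h : IntegrableOn D.h (Ioc 0 1) :=
  (integrableOn_Ioc_iff_integrable_comp_cdf D.aestronglyMeasurable_h).2
    (D.integrable_virtualValue.congr D.h_F_ae_eq.symm)

theorem setIntegral_Iic_virtualValue (z : ℝ) :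
    ∫ w in Iic z, D.virtualValue w ∂D.law = D.H (D.F z) :=
  calc ∫ w in Iic z, D.virtualValue w ∂D.law = ∫ w in Iic z, D.h (D.F w) ∂D.law :=
        integral_congr_ae (ae_restrict_of_ae D.h_F_ae_eq.symm)
    _ = D.H (D.F z) := (intervalIntegral_cdf_eq D.aestronglyMeasurable_h z).symm

theorem H_zero : D.H 0 = 0 := intervalIntegral.integral_same

theorem H_nonneg {q : ℝ} (hq : 0 ≤ q) : 0 ≤ D.H q :=
  intervalIntegral.integral_nonneg hq fun _ _ => D.virtualValue_nonneg _

theorem continuousOn_H : ContinuousOn D.H (Icc 0 1) := by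
  have h := D.integrableOn_h
  rw [← integrableOn_Icc_iff_integrableOn_Ioc, ← uIcc_of_le (zero_le_one' ℝ)] at h
  rw [← uIcc_of_le (zero_le_one' ℝ)]
  exact intervalIntegral.continuousOn_primitive_interval h

theorem bddBelow_image_H : BddBelow (D.H '' Icc 0 1) :=
  isCompact_Icc.bddBelow_image D.continuousOn_H

theorem G_le_H {q : ℝ} (hq : q ∈ Icc 0 1) : D.G q ≤ D.H q :=
  convexMinorant_le (convex_Icc 0 1) D.bddBelow_image_H hq

theorem G_zero : D.G 0 = 0 :=
  (convexMinorant_left zero_le_one D.continuousOn_H).trans D.H_zero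

theorem G_one : D.G 1 = D.H 1 := convexMinorant_right zero_le_one D.continuousOn_H

theorem convexOn_G : ConvexOn ℝ (Icc 0 1) D.G :=
  convexOn_convexMinorant (convex_Icc 0 1) D.bddBelow_image_H

theorem continuousOn_G : ContinuousOn D.G (Icc 0 1) := continuousOn_convexMinorant D.continuousOn_H

theorem isMinOn_G_zero : IsMinOn D.G (Icc 0 1) 0 := fun _ hq =>
  D.G_zero.trans_le <| le_convexMinorant (convexOn_const 0 (convex_Icc 0 1))
    (fun _ hr => D.H_nonneg hr.1) hq

theorem g_of_lt_one {q : ℝ} (hq : q < 1) : D.g q = derivWithin D.G (Ioi q) q := if_pos hq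

theorem g_nonneg {q : ℝ} (hq : q ∈ Ioo 0 1) : 0 ≤ D.g q := by
  rw [D.g_of_lt_one hq.2]
  exact rightDeriv_nonneg_of_isMinOn_left D.convexOn_G D.isMinOn_G_zero hq

theorem hasDerivWithinAt_G {q : ℝ} (hq : q ∈ Ioo 0 1) :
    HasDerivWithinAt D.G (D.g q) (Ioi q) q := by
  rw [D.g_of_lt_one hq.2]
  exact D.convexOn_G.hasDerivWithinAt_rightDeriv_of_mem_interior (by rwa [interior_Icc])

theorem integrableOn_g : IntegrableOn D.g (Ioc 0 1) :=
  intervalIntegral.integrableOn_deriv_right_of_nonneg D.continuousOn_G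
    (fun _ hq => D.hasDerivWithinAt_G hq) fun _ hq => D.g_nonneg hq

theorem integral_g {q : ℝ} (hq : q ∈ Icc 0 1) : ∫ r in (0 : ℝ)..q, D.g r = D.G q := by
  rw [intervalIntegral.integral_eq_sub_of_hasDeriv_right_of_le hq.1
    (D.continuousOn_G.mono (Icc_subset_Icc_right hq.2))
    (fun r hr => D.hasDerivWithinAt_G ⟨hr.1, hr.2.trans_le hq.2⟩)
    ((intervalIntegrable_iff_integrableOn_Ioc_of_le hq.1).2
      (D.integrableOn_g.mono_set (Ioc_subset_Ioc_right hq.2))), G_zero, sub_zero]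

theorem integrable_ironed : Integrable D.ironed D.law :=
  (integrableOn_Ioc_iff_integrable_comp_cdf D.integrableOn_g.aestronglyMeasurable).1
    D.integrableOn_g

theorem setIntegral_Iic_ironed (z : ℝ) : ∫ w in Iic z, D.ironed w ∂D.law = D.G (D.F z) :=
  calc ∫ w in Iic z, D.ironed w ∂D.law = ∫ q in (0 : ℝ)..D.F z, D.g q :=
        (intervalIntegral_cdf_eq D.integrableOn_g.aestronglyMeasurable z).symm
    _ = D.G (D.F z) := D.integral_g (D.F_mem_Icc z)

theorem integrable_virtualValue_sub_ironed :
    Integrable (fun z => D.virtualValue z - D.ironed z) D.law :=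
  D.integrable_virtualValue.sub D.integrable_ironed

theorem setIntegral_Iic_virtualValue_sub_ironed (z : ℝ) :
    ∫ w in Iic z, (D.virtualValue w - D.ironed w) ∂D.law = D.H (D.F z) - D.G (D.F z) := by
  rw [integral_sub D.integrable_virtualValue.integrableOn D.integrable_ironed.integrableOn,
    setIntegral_Iic_virtualValue, setIntegral_Iic_ironed]

theorem integral_virtualValue_sub_ironed :
    ∫ z, (D.virtualValue z - D.ironed z) ∂D.law = 0 := by
  have hfull : ∀ᵐ z ∂D.law, z ∈ Iic D.b := D.ae_mem_Icc.mono fun _ hz => hz.2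
  rw [← Measure.restrict_eq_self_of_ae_mem hfull, setIntegral_Iic_virtualValue_sub_ironed, F_b,
    G_one, sub_self]

theorem setIntegral_Ioi_virtualValue_sub_ironed (z : ℝ) :
    ∫ w in Ioi z, (D.virtualValue w - D.ironed w) ∂D.law = D.G (D.F z) - D.H (D.F z) := by
  rw [← compl_Iic, setIntegral_compl measurableSet_Iic D.integrable_virtualValue_sub_ironed,
    integral_virtualValue_sub_ironed, setIntegral_Iic_virtualValue_sub_ironed, zero_sub, neg_sub]

theorem eventuallyConst_ironed {z : ℝ} (hz : z ∈ Ioo 0 D.b) (hGH : D.G (D.F z) < D.H (D.F z)) :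
    EventuallyConst D.ironed (𝓝 z) := by
  have hFz := D.F_mem_Ioo hz
  have hg : D.g =ᶠ[𝓝 (D.F z)] fun r => derivWithin D.G (Ioi r) r := by
    filter_upwards [Iio_mem_nhds hFz.2] with r hr using D.g_of_lt_one hr
  have hconst : EventuallyConst D.g (𝓝 (D.F z)) := hg.eventuallyConst_iff.2 <|
    eventuallyConst_derivWithin_Ioi_convexMinorant (convex_Icc 0 1) D.bddBelow_image_H
      (by rwa [interior_Icc]) (D.continuousOn_H.continuousAt (Icc_mem_nhds hFz.1 hFz.2)) hGH
  exact hconst.comp_tendsto D.continuous_F.continuousAt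

variable {D} {x : ℝ → ℝ}

theorem integral_virtualValue_mul_sub_integral_ironed_mul (hxm : Measurable x)
    (hx01 : ∀ z, x z ∈ Icc 0 1) :
    ∫ z, D.virtualValue z * x z ∂D.law - ∫ z, D.ironed z * x z ∂D.law
      = ∫ z, (D.virtualValue z - D.ironed z) * x z ∂D.law := by
  simp_rw [sub_mul]
  exact (integral_sub (integrable_mul_of_mem_Icc D.integrable_virtualValue hxm hx01)
    (integrable_mul_of_mem_Icc D.integrable_ironed hxm hx01)).symm

theorem integral_virtualValue_mul_le_integral_ironed_mul (hxm : Measurable x)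
    (hx01 : ∀ z, x z ∈ Icc 0 1) (hx : MonotoneOn x (Icc 0 D.b)) :
    ∫ z, D.virtualValue z * x z ∂D.law ≤ ∫ z, D.ironed z * x z ∂D.law := by
  rw [← sub_nonpos, integral_virtualValue_mul_sub_integral_ironed_mul hxm hx01]
  refine integral_mul_nonpos_of_setIntegral_Ioi_nonpos D.b_pos.le D.ae_mem_Icc
    D.integrable_virtualValue_sub_ironed (fun z _ => ?_) hxm hx01 hx
  rw [D.setIntegral_Ioi_virtualValue_sub_ironed, sub_nonpos]
  exact D.G_le_H (D.F_mem_Icc z)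

theorem integral_virtualValue_mul_eq_integral_ironed_mul (hxm : Measurable x)
    (hx01 : ∀ z, x z ∈ Icc 0 1) (hx : MonotoneOn x (Icc 0 D.b))
    (hflat : ∀ z ∈ Ioo 0 D.b, HasDerivAt D.ironed 0 z → HasDerivAt x 0 z) :
    ∫ z, D.virtualValue z * x z ∂D.law = ∫ z, D.ironed z * x z ∂D.law := by
  rw [← sub_eq_zero, integral_virtualValue_mul_sub_integral_ironed_mul hxm hx01]
  refine integral_mul_eq_zero_of_eventuallyConst D.b_pos.le D.ae_mem_Icc
    D.integrable_virtualValue_sub_ironed D.integral_virtualValue_sub_ironed hxm hx01 hx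
    fun z hz hne => ?_
  rw [D.setIntegral_Ioi_virtualValue_sub_ironed, sub_ne_zero] at hne
  have hironed := D.eventuallyConst_ironed hz ((D.G_le_H (D.F_mem_Icc z)).lt_of_ne hne)
  rw [eventuallyConst_nhds_iff_hasDerivAt_zero] at hironed ⊢
  filter_upwards [hironed, Ioo_mem_nhds hz.1 hz.2] with w hw hwI using hflat w hwI hw

end Ironing

end ValuationDist

section PiMeasure

variable {ι : Type*} [Fintype ι] [DecidableEq ι] {α : ι → Type*} [∀ i, MeasurableSpace (α i)]
  (μ : ∀ i, Measure (α i)) [∀ i, SigmaFinite (μ i)] (i : ι) [IsProbabilityMeasure (μ i)]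

theorem measurePreserving_update :
    MeasurePreserving (fun p : (∀ j, α j) × α i => Function.update p.1 i p.2)
      ((Measure.pi μ).prod (μ i)) (Measure.pi μ) := by
  refine ⟨measurable_update', (Measure.pi_eq fun s hs => ?_).symm⟩
  have hpre : (fun p : (∀ j, α j) × α i => Function.update p.1 i p.2) ⁻¹' univ.pi s
      = univ.pi (Function.update s i univ) ×ˢ s i := by
    ext p
    simp only [mem_preimage, mem_univ_pi, mem_prod]
    rw [Function.forall_update_iff p.1 fun j y => y ∈ s j,
      Function.forall_update_iff s fun j t => p.1 j ∈ t]
    simp [and_comm]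
  rw [Measure.map_apply measurable_update' (.univ_pi hs), hpre, Measure.prod_prod, Measure.pi_pi,
    ← Finset.prod_erase_mul _ _ (Finset.mem_univ i),
    ← Finset.prod_erase_mul _ (fun j => μ j (s j)) (Finset.mem_univ i), Function.update_self,
    measure_univ, mul_one]
  congr 1
  refine Finset.prod_congr rfl fun j hj => ?_
  rw [Function.update_of_ne (Finset.ne_of_mem_erase hj)]

theorem integral_pi_update {E : Type*} [NormedAddCommGroup E] [NormedSpace ℝ E]
    {φ : (∀ j, α j) → E} (hφ : Integrable φ (Measure.pi μ)) :
    ∫ v, φ v ∂Measure.pi μ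
      = ∫ z, (∫ v, φ (Function.update v i z) ∂Measure.pi μ) ∂μ i := by
  have hp := measurePreserving_update μ i
  rw [← integral_prod_symm (fun p : (∀ j, α j) × α i => φ (Function.update p.1 i p.2))
      (hp.integrable_comp_of_integrable hφ)]
  conv_lhs => rw [← hp.map_eq]
  exact integral_map hp.measurable.aemeasurable (by rw [hp.map_eq]; exact hφ.aestronglyMeasurable)

end PiMeasure

theorem sum_mul_le_of_isMaxOn {α : Type*} [Fintype α] {p q S : α → ℝ} {X : Set α}
    (hp : p ∈ stdSimplex ℝ α) (hq : q ∈ stdSimplex ℝ α) (hpX : ∀ x, 0 < p x → x ∈ X)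
    (hqX : ∀ x, 0 < q x → x ∈ X) (hmax : ∀ x, 0 < p x → IsMaxOn S X x) :
    ∑ x, q x * S x ≤ ∑ x, p x * S x := by
  obtain ⟨y, -, hy⟩ : ∃ y ∈ Finset.univ, 0 < p y :=
    Finset.exists_lt_of_sum_lt (f := fun _ => 0) (by simp [hp.2])
  calc ∑ x, q x * S x ≤ ∑ x, q x * S y := Finset.sum_le_sum fun x _ => by
        rcases (hq.1 x).eq_or_lt with hx | hx
        · simp [← hx]
        · exact mul_le_mul_of_nonneg_left (hmax y hy (hqX x hx)) hx.le
    _ = ∑ x, p x * S y := by rw [← Finset.sum_mul, ← Finset.sum_mul, hp.2, hq.2]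
    _ ≤ ∑ x, p x * S x := Finset.sum_le_sum fun x _ => by
        rcases (hp.1 x).eq_or_lt with hx | hx
        · simp [← hx]
        · exact mul_le_mul_of_nonneg_left (hmax x hx (hpX y hy)) hx.le

variable {n : ℕ}

theorem Allocation.entry_mem_Icc (x : Allocation n) (i : Fin n) : x.entry i ∈ Icc (0 : ℝ) 1 := by
  rw [Allocation.entry]
  split_ifs <;> simp

section JointLaw

variable (D : Fin n → ValuationDist)

instance : IsProbabilityMeasure (jointLaw D) := by
  rw [jointLaw]
  infer_instance

theorem measurePreserving_eval_jointLaw (i : Fin n) :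
    MeasurePreserving (Function.eval i) (jointLaw D) (D i).law :=
  measurePreserving_eval (fun j => (D j).law) i

theorem measurePreserving_update_jointLaw (i : Fin n) :
    MeasurePreserving (fun p : (Fin n → ℝ) × ℝ => Function.update p.1 i p.2)
      ((jointLaw D).prod (D i).law) (jointLaw D) :=
  measurePreserving_update (fun j => (D j).law) i

variable {D}

theorem integral_jointLaw_eq {φ : (Fin n → ℝ) → ℝ} (hφ : Integrable φ (jointLaw D)) (i : Fin n) :
    ∫ v, φ v ∂jointLaw D
      = ∫ z, (∫ v, φ (Function.update v i z) ∂jointLaw D) ∂(D i).law :=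
  integral_pi_update (fun j => (D j).law) i hφ

variable (D) in
theorem ae_mem_typeSpace : ∀ᵐ v ∂jointLaw D, v ∈ typeSpace D :=
  ae_all_iff.2 fun i =>
    (measurePreserving_eval_jointLaw D i).quasiMeasurePreserving.ae (D i).ae_mem_Icc

theorem update_mem_typeSpace {v : Fin n → ℝ} (hv : v ∈ typeSpace D) {i : Fin n} {z : ℝ}
    (hz : z ∈ Icc 0 (D i).b) : Function.update v i z ∈ typeSpace D :=
  (Function.forall_update_iff v fun j y => y ∈ Icc 0 (D j).b).2 ⟨hz, fun j _ => hv j⟩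

end JointLaw

namespace DirectMechanism

/-- The interim utility `z xᵢ(z) - pᵢ(z)` of agent `i` when its valuation is `z` and all agents
report truthfully. -/
noncomputable def interimUtility (M : DirectMechanism n) (D : Fin n → ValuationDist) (i : Fin n)
    (z : ℝ) : ℝ :=
  z * M.interimAlloc D i z - M.interimPay D i z

/-- The expected service cost `E[c(x(v))]`. -/
noncomputable def expectedCost (M : DirectMechanism n) (D : Fin n → ValuationDist)
    (c : Allocation n → ℝ) : ℝ :=
  ∫ v, ∑ x, M.lottery v x * c x ∂jointLaw D

/-- The expected ironed virtual surplus `E[∑ᵢ ϑ̄ᵢ(vᵢ) xᵢ(v) - c(x(v))]`, which bounds the expected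
residual surplus of an admissible mechanism from above. -/
noncomputable def expectedIronedSurplus (M : DirectMechanism n) (D : Fin n → ValuationDist)
    (c : Allocation n → ℝ) : ℝ :=
  ∫ v, ∑ x, M.lottery v x * ironedVirtualSurplus D c v x ∂jointLaw D

theorem sum_lottery_mul_ironedVirtualSurplus (M : DirectMechanism n) (D : Fin n → ValuationDist)
    (c : Allocation n → ℝ) (v : Fin n → ℝ) :
    ∑ x, M.lottery v x * ironedVirtualSurplus D c v x
      = ∑ i, (D i).ironed (v i) * M.alloc v i - ∑ x, M.lottery v x * c x := by
  simp only [ironedVirtualSurplus, alloc, mul_sub, Finset.sum_sub_distrib, Finset.mul_sum,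
    mul_left_comm (M.lottery v _)]
  rw [Finset.sum_comm]

namespace IsAdmissible

variable {M : DirectMechanism n} {D : Fin n → ValuationDist} {X : Set (Allocation n)}

section Alloc

theorem integrable_lottery (hM : M.IsAdmissible D X) (x : Allocation n) :
    Integrable (fun v => M.lottery v x) (jointLaw D) :=
  Integrable.of_mem_Icc 0 1 (hM.measurable_lottery x).aemeasurable
    (ae_of_all _ fun v => mem_Icc_of_mem_stdSimplex (hM.lottery_mem v) x)

theorem integrable_cost (hM : M.IsAdmissible D X) (c : Allocation n → ℝ) :
    Integrable (fun v => ∑ x, M.lottery v x * c x) (jointLaw D) :=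
  integrable_finsetSum _ fun x _ => (hM.integrable_lottery x).mul_const (c x)

theorem measurable_alloc (hM : M.IsAdmissible D X) (i : Fin n) : Measurable fun v => M.alloc v i :=
  Finset.measurable_fun_sum _ fun x _ => (hM.measurable_lottery x).mul_const _

theorem alloc_mem_Icc (hM : M.IsAdmissible D X) (v : Fin n → ℝ) (i : Fin n) :
    M.alloc v i ∈ Icc (0 : ℝ) 1 :=
  (convex_Icc 0 1).sum_mem (fun x _ => (hM.lottery_mem v).1 x) (hM.lottery_mem v).2
    fun x _ => x.entry_mem_Icc i

theorem integrable_alloc_update (hM : M.IsAdmissible D X) (i : Fin n) (z : ℝ) :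
    Integrable (fun v => M.alloc (Function.update v i z) i) (jointLaw D) :=
  Integrable.of_mem_Icc 0 1
    ((hM.measurable_alloc i).comp (measurable_update'.comp measurable_prodMk_right)).aemeasurable
    (ae_of_all _ fun _ => hM.alloc_mem_Icc _ i)

theorem measurable_interimAlloc (hM : M.IsAdmissible D X) (i : Fin n) :
    Measurable (M.interimAlloc D i) :=
  ((hM.measurable_alloc i).comp
    measurable_update').stronglyMeasurable.integral_prod_left'.measurable

theorem interimAlloc_mem_Icc (hM : M.IsAdmissible D X) (i : Fin n) (z : ℝ) :
    M.interimAlloc D i z ∈ Icc (0 : ℝ) 1 :=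
  (convex_Icc 0 1).integral_mem isClosed_Icc (ae_of_all _ fun _ => hM.alloc_mem_Icc _ i)
    (hM.integrable_alloc_update i z)

variable {ψ : ℝ → ℝ} {i : Fin n}

theorem integrable_mul_alloc (hM : M.IsAdmissible D X) (hψ : Integrable ψ (D i).law) :
    Integrable (fun v => ψ (v i) * M.alloc v i) (jointLaw D) :=
  integrable_mul_of_mem_Icc ((measurePreserving_eval_jointLaw D i).integrable_comp_of_integrable hψ)
    (hM.measurable_alloc i) (hM.alloc_mem_Icc · i)

theorem integral_mul_alloc (hM : M.IsAdmissible D X) (hψ : Integrable ψ (D i).law) :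
    ∫ v, ψ (v i) * M.alloc v i ∂jointLaw D = ∫ z, ψ z * M.interimAlloc D i z ∂(D i).law := by
  rw [integral_jointLaw_eq (hM.integrable_mul_alloc hψ) i]
  simp only [Function.update_self, integral_const_mul, interimAlloc]

end Alloc

section Pay

variable {i : Fin n} {z : ℝ}

theorem pay_update_nonneg (hM : M.IsAdmissible D X) (hz : z ∈ Icc 0 (D i).b) :
    ∀ᵐ v ∂jointLaw D, 0 ≤ M.pay (Function.update v i z) i := by
  filter_upwards [ae_mem_typeSpace D] with v hv
  exact hM.pay_nonneg _ (update_mem_typeSpace hv hz) i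

theorem interimPay_mem_Icc (hM : M.IsAdmissible D X) (hz : z ∈ Icc 0 (D i).b) :
    M.interimPay D i z ∈ Icc 0 z := by
  refine ⟨integral_nonneg_of_ae (hM.pay_update_nonneg hz), ?_⟩
  calc M.interimPay D i z ≤ z * M.interimAlloc D i z :=
        sub_nonneg.1 (hM.individuallyRational i z hz)
    _ ≤ z := mul_le_of_le_one_right hz.1 (hM.interimAlloc_mem_Icc i z).2

theorem integral_norm_pay_update (hM : M.IsAdmissible D X) (hz : z ∈ Icc 0 (D i).b) :
    ∫ v, ‖M.pay (Function.update v i z) i‖ ∂jointLaw D = M.interimPay D i z :=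
  integral_congr_ae <| (hM.pay_update_nonneg hz).mono fun _ hv => Real.norm_of_nonneg hv

variable (i) in
theorem integrable_pay_jointLaw (hM : M.IsAdmissible D X) :
    Integrable (fun v => M.pay v i) (jointLaw D) := by
  have hp := measurePreserving_update_jointLaw D i
  have hpay : Measurable fun p : (Fin n → ℝ) × ℝ => M.pay (Function.update p.1 i p.2) i :=
    (hM.measurable_pay i).comp hp.measurable
  rw [← hp.integrable_comp (hM.measurable_pay i).aestronglyMeasurable]
  refine (integrable_prod_iff' hpay.aestronglyMeasurable).2 ⟨?_, ?_⟩
  · exact (D i).ae_mem_Icc.mono fun z hz => hM.integrable_pay i z hz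
  · refine Integrable.of_mem_Icc 0 (D i).b
      hpay.norm.stronglyMeasurable.integral_prod_left'.measurable.aemeasurable ?_
    filter_upwards [(D i).ae_mem_Icc] with z hz
    rw [hM.integral_norm_pay_update hz]
    exact ⟨(hM.interimPay_mem_Icc hz).1, (hM.interimPay_mem_Icc hz).2.trans hz.2⟩

end Pay

section Utility

variable (i : Fin n)

theorem isSubgradientOn_interimUtility (hM : M.IsAdmissible D X) :
    IsSubgradientOn (M.interimAlloc D i) (M.interimUtility D i) (Icc 0 (D i).b) := by
  intro z hz w hw
  have := hM.incentiveCompatible i w hw z hz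
  rw [interimUtility, interimUtility]
  linarith

theorem monotoneOn_interimAlloc (hM : M.IsAdmissible D X) :
    MonotoneOn (M.interimAlloc D i) (Icc 0 (D i).b) :=
  (hM.isSubgradientOn_interimUtility i).monotoneOn

theorem interimUtility_zero (hM : M.IsAdmissible D X) : M.interimUtility D i 0 = 0 := by
  have hpay := hM.interimPay_mem_Icc (i := i) (left_mem_Icc.2 (D i).b_pos.le)
  rw [Icc_self, mem_singleton_iff] at hpay
  rw [interimUtility, hpay, zero_mul, sub_zero]

theorem integrable_utility (hM : M.IsAdmissible D X) :
    Integrable (fun v => v i * M.alloc v i - M.pay v i) (jointLaw D) :=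
  (hM.integrable_mul_alloc (D i).integrable_id).sub (hM.integrable_pay_jointLaw i)

theorem integral_utility (hM : M.IsAdmissible D X) :
    ∫ v, (v i * M.alloc v i - M.pay v i) ∂jointLaw D
      = ∫ z, M.interimUtility D i z ∂(D i).law := by
  rw [integral_jointLaw_eq (hM.integrable_utility i) i]
  refine integral_congr_ae ((D i).ae_mem_Icc.mono fun z hz => ?_)
  simp only [Function.update_self]
  rw [integral_sub ((hM.integrable_alloc_update i z).const_mul z) (hM.integrable_pay i z hz),
    integral_const_mul, interimUtility, interimAlloc, interimPay]

theorem integral_utility_eq_integral_virtualValue_mul (hM : M.IsAdmissible D X) :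
    ∫ v, (v i * M.alloc v i - M.pay v i) ∂jointLaw D
      = ∫ z, (D i).virtualValue z * M.interimAlloc D i z ∂(D i).law := by
  rw [hM.integral_utility i, (D i).integral_virtualValue_mul_eq
    (hM.isSubgradientOn_interimUtility i) (hM.interimUtility_zero i)]

end Utility

section Surplus

variable (c : Allocation n → ℝ)

theorem expectedResidualSurplus_eq (hM : M.IsAdmissible D X) :
    M.expectedResidualSurplus D c
      = ∑ i, ∫ z, (D i).virtualValue z * M.interimAlloc D i z ∂(D i).law
        - M.expectedCost D c := by
  simp_rw [expectedResidualSurplus, expectedCost,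
    ← hM.integral_utility_eq_integral_virtualValue_mul]
  rw [integral_sub (integrable_finsetSum _ fun i _ => hM.integrable_utility i)
    (hM.integrable_cost c), integral_finsetSum _ fun i _ => hM.integrable_utility i]

theorem integrable_sum_ironed_mul_alloc (hM : M.IsAdmissible D X) :
    Integrable (fun v => ∑ i, (D i).ironed (v i) * M.alloc v i) (jointLaw D) :=
  integrable_finsetSum _ fun i _ => hM.integrable_mul_alloc (D i).integrable_ironed

theorem integrable_sum_lottery_mul_ironedVirtualSurplus (hM : M.IsAdmissible D X) :
    Integrable (fun v => ∑ x, M.lottery v x * ironedVirtualSurplus D c v x) (jointLaw D) := by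
  simp_rw [sum_lottery_mul_ironedVirtualSurplus]
  exact hM.integrable_sum_ironed_mul_alloc.sub (hM.integrable_cost c)

theorem expectedIronedSurplus_eq (hM : M.IsAdmissible D X) :
    M.expectedIronedSurplus D c
      = ∑ i, ∫ z, (D i).ironed z * M.interimAlloc D i z ∂(D i).law - M.expectedCost D c := by
  simp_rw [expectedIronedSurplus, expectedCost, sum_lottery_mul_ironedVirtualSurplus,
    ← hM.integral_mul_alloc (D _).integrable_ironed]
  rw [integral_sub hM.integrable_sum_ironed_mul_alloc (hM.integrable_cost c),
    integral_finsetSum _ fun i _ => hM.integrable_mul_alloc (D i).integrable_ironed]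

theorem expectedResidualSurplus_le_expectedIronedSurplus (hM : M.IsAdmissible D X) :
    M.expectedResidualSurplus D c ≤ M.expectedIronedSurplus D c := by
  rw [hM.expectedResidualSurplus_eq, hM.expectedIronedSurplus_eq]
  refine sub_le_sub_right (Finset.sum_le_sum fun i _ => ?_) _
  exact ValuationDist.integral_virtualValue_mul_le_integral_ironed_mul
    (hM.measurable_interimAlloc i) (hM.interimAlloc_mem_Icc i) (hM.monotoneOn_interimAlloc i)

theorem expectedResidualSurplus_eq_expectedIronedSurplus (hM : M.IsAdmissible D X)
    (hflat : ∀ i, ∀ z ∈ Ioo 0 (D i).b,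
      HasDerivAt (D i).ironed 0 z → HasDerivAt (M.interimAlloc D i) 0 z) :
    M.expectedResidualSurplus D c = M.expectedIronedSurplus D c := by
  rw [hM.expectedResidualSurplus_eq, hM.expectedIronedSurplus_eq]
  congr! 2 with i
  exact ValuationDist.integral_virtualValue_mul_eq_integral_ironed_mul
    (hM.measurable_interimAlloc i) (hM.interimAlloc_mem_Icc i) (hM.monotoneOn_interimAlloc i)
    (hflat i)

variable {c} {M' : DirectMechanism n}

theorem expectedIronedSurplus_le_of_isMaxOn (hM : M.IsAdmissible D X) (hM' : M'.IsAdmissible D X)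
    (hmax : ∀ᵐ v ∂jointLaw D, ∀ x, 0 < M.lottery v x → IsMaxOn (ironedVirtualSurplus D c v) X x) :
    M'.expectedIronedSurplus D c ≤ M.expectedIronedSurplus D c := by
  refine integral_mono_ae (hM'.integrable_sum_lottery_mul_ironedVirtualSurplus c)
    (hM.integrable_sum_lottery_mul_ironedVirtualSurplus c) ?_
  filter_upwards [hmax, ae_mem_typeSpace D] with v hv hvD
  exact sum_mul_le_of_isMaxOn (hM.lottery_mem v) (hM'.lottery_mem v) (hM.feasible v hvD)
    (hM'.feasible v hvD) hv

end Surplus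

end IsAdmissible

end DirectMechanism

end MoneyBurning

theorem theoremt (n : ℕ) (D : Fin n → MoneyBurning.ValuationDist)
    (X : Set (MoneyBurning.Allocation n)) (c : MoneyBurning.Allocation n → ℝ)
    (M : MoneyBurning.DirectMechanism n) (hM : M.IsAdmissible D X)
    (hmax : ∀ᵐ v ∂(MoneyBurning.jointLaw D), ∀ x, 0 < M.lottery v x →
      IsMaxOn (MoneyBurning.ironedVirtualSurplus D c v) X x)
    (hflat : ∀ i, ∀ z ∈ Set.Ioo 0 (D i).b,
      HasDerivAt (D i).ironed 0 z → HasDerivAt (M.interimAlloc D i) 0 z) :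
    M.IsOptimal D X c := by
  refine ⟨hM, fun M' hM' => ?_⟩
  calc M'.expectedResidualSurplus D c
      ≤ M'.expectedIronedSurplus D c := hM'.expectedResidualSurplus_le_expectedIronedSurplus c
    _ ≤ M.expectedIronedSurplus D c := hM.expectedIronedSurplus_le_of_isMaxOn hM' hmax
    _ = M.expectedResidualSurplus D c :=
        (hM.expectedResidualSurplus_eq_expectedIronedSurplus c hflat).symm
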